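/- Let $k\ge 1$ and let $\theta=(\mu_1,\dots,\mu_k,\sigma_1,\dots,\sigma_k)$ parametrize the $k$-dimensional Gaussian law $N_\theta=N\big((\mu_1,\dots,\mu_k),\operatorname{diag}(\sigma_1^2,\dots,\sigma_k^2)\big)$. Let $g_1,\dots,g_d$ ($1\le d\le 2k$) be distinct coordinates of $\theta$ (the secrets), let $\epsilon_1,\dots,\epsilon_d>0$ be tolerance ranges and $s_{g_1},\dots,s_{g_d}$ interval lengths with $2\epsilon_i<s_{g_i}$. The parameter $\theta$ is random with a prior law $P$ under which all $\sigma_j\ge 0$ almost surely; each secret $g_i(\theta)$ is uniform on $[\underline{g_i},\,\underline{g_i}+m_i s_{g_i}]$ for some integer $m_i\ge 1$; and the secrets are mutually independent and independent of the vector of non-secret coordinates, whose law is arbitrary. A mechanism is a Markov kernel $\mathcal M$ on $\mathbb R^{2k}$ that maps $\theta$ to a random released parameter $\theta'\sim\mathcal M(\theta)$. Its union privacy is $$\Pi^{\mathrm{union}}(\mathcal M)=\sup_{\hat g}\ \mathbb P\Big(\exists\, i\in\{1,\dots,d\}:\ |\hat g_i(\theta')-g_i(\theta)|\le\epsilon_i\Big),$$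 the supremum being over all (possibly randomized) attack strategies $\hat g=(\hat g_1,\dots,\hat g_d)$, and its distortion is $$\Delta(\mathcal M)=\sup_{\theta\in\operatorname{supp}P,\ \theta'\in\operatorname{supp}\mathcal M(\theta)} W_2(N_\theta,N_{\theta'}),$$ where $W_2$ is the Wasserstein-2 distance. Let $\mathcal M_{\mathrm{Alg}}$ be the quantization mechanism that replaces each secret $g_i(\theta)$ by $$\underline{g_i}+\Big\lfloor\frac{g_i(\theta)-\underline{g_i}}{s_{g_i}}\Big\rfloor s_{g_i}+U_i,$$ with independent $U_i$ uniform on $(0,s_{g_i})$, and keeps all non-secret coordinates. Then $$\Pi^{\mathrm{union}}(\mathcal M_{\mathrm{Alg}})=1-\prod_{i=1}^d\Big(1-\frac{2\epsilon_i}{s_{g_i}}\Big),\qquad \Delta(\mathcal M_{\mathrm{Alg}})=\sqrt{\sum_{i=1}^d s_{g_i}^2}.$$ Moreover, let $\Delta_{\mathrm{opt}}=\inf\{\Delta(\mathcal M):\ \Pi^{\mathrm{union}}(\mathcal M)\le \Pi^{\mathrm{union}}(\mathcal M_{\mathrm{Alg}})\}$ be the optimal distortion at the same privacy level, and put $c_1=\min_i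 \epsilon_i/s_{g_i}$, $c_2=\max_i\epsilon_i/s_{g_i}$ and $$C_{\epsilon,s}=\frac{\sqrt{\sum_{i}\epsilon_i^2}}{\big(\prod_{i}\epsilon_i\big)^{1/d}}\cdot\frac{2c_2}{c_1(1-2c_2)},$$ which depends only on the tolerance ranges and the interval lengths. Then $\Delta(\mathcal M_{\mathrm{Alg}})<c\,\Delta_{\mathrm{opt}}$ for every real $c>C_{\epsilon,s}$. -/

import Mathlib

open MeasureTheory ProbabilityTheory
open scoped ENNReal

noncomputable section

/-- Parameter vectors `θ = (μ₁, …, μ_k, σ₁, …, σ_k)` of `k`-dimensional Gaussian distributions with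
diagonal covariance matrix: `θ (Sum.inl j) = μ_j` and `θ (Sum.inr j) = σ_j`. -/
abbrev GaussParam (k : ℕ) : Type := Fin k ⊕ Fin k → ℝ

/-- The Gaussian distribution `N((μ₁, …, μ_k), diag(σ₁², …, σ_k²))` on Euclidean space. -/
def gaussLaw {k : ℕ} (θ : GaussParam k) : Measure (EuclideanSpace ℝ (Fin k)) :=
  multivariateGaussian (WithLp.toLp 2 fun j => θ (Sum.inl j))
    (Matrix.diagonal fun j => θ (Sum.inr j) ^ 2)

/-- The Wasserstein-2 distance: the square root of the least expected squared distance over all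
couplings of `μ` and `ν`. -/
def wasserstein2 {E : Type*} [PseudoEMetricSpace E] [MeasurableSpace E] (μ ν : Measure E) :
    ℝ≥0∞ :=
  (⨅ (π : Measure (E × E)) (_ : π.map Prod.fst = μ) (_ : π.map Prod.snd = ν),
    ∫⁻ z, edist z.1 z.2 ^ 2 ∂π) ^ (1 / 2 : ℝ)

/-- Union privacy of the mechanism `M` for the secrets `θ ↦ θ (g i)`, with prior `P` and tolerance
ranges `ε i`: the supremum, over all (possibly randomized) attack strategies `A`, of the probability
that for at least one `i` the guess of the `i`-th secret made from the released parameter is within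
`ε i` of its true value. -/
def unionPrivacy {k d : ℕ} (P : Measure (GaussParam k)) (g : Fin d → Fin k ⊕ Fin k)
    (ε : Fin d → ℝ) (M : Kernel (GaussParam k) (GaussParam k)) : ℝ≥0∞ :=
  ⨆ (A : Kernel (GaussParam k) (Fin d → ℝ)) (_ : IsMarkovKernel A),
    ∫⁻ θ, ∫⁻ θ', A θ' {guess | ∃ i, |guess i - θ (g i)| ≤ ε i} ∂(M θ) ∂P

/-- Distortion of the mechanism `M` under the prior `P`: the worst-case Wasserstein-2 distance
between the original and the released distribution. -/
def distortion {k : ℕ} (P : Measure (GaussParam k)) (M : Kernel (GaussParam k) (GaussParam k)) :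
    ℝ≥0∞ :=
  ⨆ θ ∈ P.support, ⨆ θ' ∈ (M θ).support, wasserstein2 (gaussLaw θ) (gaussLaw θ')

/-- The optimal distortion: the infimum of the distortion over all data release mechanisms (Markov
kernels on the parameter space) with union privacy at most `T`. -/
def optDistortion {k d : ℕ} (P : Measure (GaussParam k)) (g : Fin d → Fin k ⊕ Fin k)
    (ε : Fin d → ℝ) (T : ℝ≥0∞) : ℝ≥0∞ :=
  ⨅ (M : Kernel (GaussParam k) (GaussParam k)) (_ : IsMarkovKernel M)
    (_ : unionPrivacy P g ε M ≤ T), distortion P M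

/-- The parameter released by the quantization mechanism on input `θ` when its internal noise is `u`:
the secret coordinate `g i` becomes `lo i + ⌊(θ (g i) - lo i) / s i⌋ * s i + u i`, and every
coordinate that is not a secret keeps its value. -/
def quantizeParam {k d : ℕ} (g : Fin d → Fin k ⊕ Fin k) (lo s : Fin d → ℝ) (θ : GaussParam k)
    (u : Fin d → ℝ) : GaussParam k :=
  Function.extend g (fun i => lo i + ⌊(θ (g i) - lo i) / s i⌋ * s i + u i) θ

/-- Independent noise, the `i`-th component uniform on `(0, s i)`. -/
def quantizeNoise {d : ℕ} (s : Fin d → ℝ) : Measure (Fin d → ℝ) :=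
  Measure.pi fun i => cond volume (Set.Ioo 0 (s i))

lemma measurable_quantizeParam {k d : ℕ} (g : Fin d → Fin k ⊕ Fin k) (lo s : Fin d → ℝ) :
    Measurable fun p : GaussParam k × (Fin d → ℝ) => quantizeParam g lo s p.1 p.2 := by
  classical
  refine measurable_pi_lambda _ fun j => ?_
  by_cases h : ∃ i, g i = j
  · simp only [quantizeParam, Function.extend_def, h, dite_true]
    fun_prop
  · simp only [quantizeParam, Function.extend_def, h, dite_false]
    fun_prop

/-- The quantization mechanism: quantize every secret and add independent uniform noise. -/
def quantizationMechanism {k d : ℕ} (g : Fin d → Fin k ⊕ Fin k) (lo s : Fin d → ℝ) :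
    Kernel (GaussParam k) (GaussParam k) where
  toFun θ := (quantizeNoise s).map (quantizeParam g lo s θ)
  measurable' := by
    have : SFinite (quantizeNoise s) := by unfold quantizeNoise; infer_instance
    refine Measure.measurable_of_measurable_coe _ fun B hB => ?_
    have hm := measurable_quantizeParam g lo s
    have h : ∀ θ, (quantizeNoise s).map (quantizeParam g lo s θ) B
        = quantizeNoise s (Prod.mk θ ⁻¹'
          ((fun p : GaussParam k × (Fin d → ℝ) => quantizeParam g lo s p.1 p.2) ⁻¹' B)) := by
      intro θ
      have hθ : Measurable (quantizeParam g lo s θ) :=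
        Measurable.of_uncurry_left (f := quantizeParam g lo s) hm
      rw [Measure.map_apply hθ hB]
      rfl
    simp_rw [h]
    exact measurable_measure_prodMk_left (hm hB)

/-- The secrets are mutually independent, independent of the vector of all non-secret parameters
(whose law is arbitrary), the `i`-th secret is uniform on `[lo i, hi i]`, and standard deviations
are nonnegative. -/
structure UniformSecretsPrior {k d : ℕ} (P : Measure (GaussParam k)) (g : Fin d → Fin k ⊕ Fin k)
    (lo hi : Fin d → ℝ) : Prop where
  isProbabilityMeasure : IsProbabilityMeasure P
  uniform : ∀ i, pdf.IsUniform (fun θ : GaussParam k => θ (g i)) (Set.Icc (lo i) (hi i)) P volume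
  indep : iIndepFun (fun i (θ : GaussParam k) => θ (g i)) P
  indep_nonsecret : IndepFun (fun (θ : GaussParam k) (i : Fin d) => θ (g i))
    (fun (θ : GaussParam k) (j : {j // j ∉ Set.range g}) => θ j) P
  sd_nonneg : ∀ᵐ θ ∂P, ∀ j, 0 ≤ θ (Sum.inr j)

/-- With `c₁ = minᵢ εᵢ / sᵢ` and `c₂ = maxᵢ εᵢ / sᵢ`, the constant
`√(∑ᵢ εᵢ²) / (∏ᵢ εᵢ)^(1/d) * (2 c₂ / (c₁ (1 - 2 c₂)))`. -/
def tradeoffConst {d : ℕ} (ε s : Fin d → ℝ) : ℝ :=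
  √(∑ i, ε i ^ 2) / (∏ i, ε i) ^ (1 / d : ℝ) *
    (2 * (⨆ i, ε i / s i) / ((⨅ i, ε i / s i) * (1 - 2 * ⨆ i, ε i / s i)))

end

/-!
* For diagonal Gaussian laws the Wasserstein-2 distance is the Euclidean distance between the
  vectors of means and standard deviations: any coupling satisfies Cauchy–Schwarz coordinatewise,
  and the affine images of one standard Gaussian vector attain the bound.
* The prior is invariant under quantization, and quantizing twice has the same effect as quantizing
  once. The released parameter therefore carries no more information on a secret than the cell
  containing it, in which the secret is uniform.
* If a mechanism has distortion `r`, then guessing each secret uniformly within `r + εᵢ` of its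
  released value succeeds with probability at least `1 - ∏ r / (r + εᵢ)`. Its privacy level bounds
  this probability, and the product inequality `(r + (∏ εᵢ)^(1/d))^d ≤ ∏ (r + εᵢ)` turns that into
  a lower bound for `r`.
-/

/-! ### Means, standard deviations and the Wasserstein distance -/

section Variance

variable {Ω : Type*} [MeasurableSpace Ω] {μ : Measure Ω} [IsProbabilityMeasure μ] {X Y : Ω → ℝ}

lemma covariance_le_sqrt_variance_mul_sqrt_variance (hX : MemLp X 2 μ) (hY : MemLp Y 2 μ) :
    cov[X, Y; μ] ≤ √Var[X; μ] * √Var[Y; μ] := by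
  have variance_pencil_nonneg (t : ℝ) :
      0 ≤ Var[X; μ] * (t * t) + -2 * cov[X, Y; μ] * t + Var[Y; μ] := by
    have h := variance_sub (hX.const_mul t) hY
    rw [variance_const_mul, covariance_const_mul_left] at h
    linarith [variance_nonneg ((fun ω => t * X ω) - Y) μ]
  have hdiscrim := discrim_le_zero variance_pencil_nonneg
  rw [discrim] at hdiscrim
  rw [← Real.sqrt_mul (variance_nonneg X μ)]
  exact Real.le_sqrt_of_sq_le (by linarith)

lemma sq_sqrt_variance_sub_sqrt_variance_le (hX : MemLp X 2 μ) (hY : MemLp Y 2 μ) :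
    (√Var[X; μ] - √Var[Y; μ]) ^ 2 ≤ Var[X - Y; μ] := by
  rw [variance_sub hX hY, sub_sq, Real.sq_sqrt (variance_nonneg X μ),
    Real.sq_sqrt (variance_nonneg Y μ)]
  linarith [covariance_le_sqrt_variance_mul_sqrt_variance hX hY]

lemma edist_sq_eq_ofReal (x y : ℝ) : edist x y ^ 2 = ENNReal.ofReal ((x - y) ^ 2) := by
  rw [edist_dist, ← ENNReal.ofReal_pow dist_nonneg, Real.dist_eq, sq_abs]

lemma lintegral_edist_sq (hX : MemLp X 2 μ) (hY : MemLp Y 2 μ) :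
    ∫⁻ ω, edist (X ω) (Y ω) ^ 2 ∂μ = ENNReal.ofReal ((μ[X] - μ[Y]) ^ 2 + Var[X - Y; μ]) := by
  have hsub : μ[X - Y] = μ[X] - μ[Y] :=
    integral_sub (hX.integrable one_le_two) (hY.integrable one_le_two)
  have hmean : (μ[X] - μ[Y]) ^ 2 + Var[X - Y; μ] = ∫ ω, (X - Y) ω ^ 2 ∂μ := by
    rw [variance_eq_sub (hX.sub hY), hsub, add_sub_cancel]
    rfl
  rw [hmean, ofReal_integral_eq_lintegral_ofReal (hX.sub hY).integrable_sq
    (ae_of_all _ fun _ => sq_nonneg _)]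
  simp only [edist_sq_eq_ofReal, Pi.sub_apply]

lemma edist_mean_sq_add_edist_sd_sq_le_lintegral (hX : MemLp X 2 μ) (hY : MemLp Y 2 μ) :
    edist μ[X] μ[Y] ^ 2 + edist √Var[X; μ] √Var[Y; μ] ^ 2
      ≤ ∫⁻ ω, edist (X ω) (Y ω) ^ 2 ∂μ := by
  rw [lintegral_edist_sq hX hY, edist_sq_eq_ofReal, edist_sq_eq_ofReal,
    ← ENNReal.ofReal_add (sq_nonneg _) (sq_nonneg _)]
  gcongr
  exact sq_sqrt_variance_sub_sqrt_variance_le hX hY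

end Variance

section Wasserstein

variable {E Ω : Type*} [PseudoEMetricSpace E] [MeasurableSpace E] [MeasurableSpace Ω]

lemma le_wasserstein2_iff {μ ν : Measure E} {c : ℝ≥0∞} :
    c ≤ wasserstein2 μ ν ↔ ∀ π : Measure (E × E), π.map Prod.fst = μ → π.map Prod.snd = ν →
      c ^ 2 ≤ ∫⁻ z, edist z.1 z.2 ^ 2 ∂π := by
  simp only [wasserstein2, one_div, ENNReal.le_rpow_inv_iff two_pos, ENNReal.rpow_ofNat,
    le_iInf_iff]

lemma sq_wasserstein2_map_map_le (ρ : Measure Ω) {f g : Ω → E} (hf : Measurable f)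
    (hg : Measurable g) :
    wasserstein2 (ρ.map f) (ρ.map g) ^ 2 ≤ ∫⁻ x, edist (f x) (g x) ^ 2 ∂ρ := by
  refine (le_wasserstein2_iff.1 le_rfl (ρ.map fun x => (f x, g x)) ?_ ?_).trans
    (lintegral_map_le _ _)
  · exact Measure.map_map measurable_fst (hf.prodMk hg)
  · exact Measure.map_map measurable_snd (hf.prodMk hg)

end Wasserstein

section Moments

variable {ι : Type*}

/-- The vector of means and standard deviations of the coordinates of a random vector with law
`μ`, indexed like `GaussParam`. -/
noncomputable def meanSd (μ : Measure (EuclideanSpace ℝ ι)) : EuclideanSpace ℝ (ι ⊕ ι) :=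
  WithLp.toLp 2 (Sum.elim (fun j => ∫ x, x j ∂μ) fun j => √Var[fun x => x j; μ])

/-- The affine map `x ↦ (m_j + s_j x_j)_j` with shifts `m_j = θ (Sum.inl j)` and scales
`s_j = θ (Sum.inr j)`. -/
def locationScale (θ : ι ⊕ ι → ℝ) (x : EuclideanSpace ℝ ι) : EuclideanSpace ℝ ι :=
  WithLp.toLp 2 fun j => θ (Sum.inl j) + θ (Sum.inr j) * x j

lemma measurable_locationScale (θ : ι ⊕ ι → ℝ) : Measurable (locationScale θ) :=
  (WithLp.measurable_toLp 2 _).comp (by fun_prop)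

variable [Fintype ι]

lemma euclideanSpace_edist_sq (x y : EuclideanSpace ℝ ι) :
    edist x y ^ 2 = ∑ j, edist (x j) (y j) ^ 2 := by
  rw [EuclideanSpace.edist_eq, ← ENNReal.rpow_natCast, ← ENNReal.rpow_mul]
  norm_num

lemma edist_meanSd_le_wasserstein2 {μ ν : Measure (EuclideanSpace ℝ ι)} [IsProbabilityMeasure μ]
    (hμ : MemLp id 2 μ) (hν : MemLp id 2 ν) :
    edist (meanSd μ) (meanSd ν) ≤ wasserstein2 μ ν := by
  refine le_wasserstein2_iff.2 ?_
  rintro π rfl rfl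
  have : IsProbabilityMeasure π := Measure.isProbabilityMeasure_of_map Prod.fst
  have hfst (j : ι) : MemLp (fun z => z.1 j) 2 π :=
    ((memLp_map_measure_iff hμ.1 measurable_fst.aemeasurable).1 hμ).eval_piLp j
  have hsnd (j : ι) : MemLp (fun z => z.2 j) 2 π :=
    ((memLp_map_measure_iff hν.1 measurable_snd.aemeasurable).1 hν).eval_piLp j
  calc edist (meanSd (π.map Prod.fst)) (meanSd (π.map Prod.snd)) ^ 2
      = ∑ j, (edist (∫ z, z.1 j ∂π) (∫ z, z.2 j ∂π) ^ 2
          + edist √Var[fun z => z.1 j; π] √Var[fun z => z.2 j; π] ^ 2) := by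
        rw [euclideanSpace_edist_sq, Fintype.sum_sum_type, ← Finset.sum_add_distrib]
        refine Finset.sum_congr rfl fun j _ => ?_
        have hj : Measurable fun x : EuclideanSpace ℝ ι => x j := by fun_prop
        simp only [meanSd, Sum.elim_inl, Sum.elim_inr,
          integral_map measurable_fst.aemeasurable hj.aestronglyMeasurable,
          integral_map measurable_snd.aemeasurable hj.aestronglyMeasurable,
          variance_map hj.aemeasurable measurable_fst.aemeasurable,
          variance_map hj.aemeasurable measurable_snd.aemeasurable, Function.comp_def]
    _ ≤ ∑ j, ∫⁻ z, edist (z.1 j) (z.2 j) ^ 2 ∂π := by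
        gcongr with j
        exact edist_mean_sq_add_edist_sd_sq_le_lintegral (hfst j) (hsnd j)
    _ = ∫⁻ z, edist z.1 z.2 ^ 2 ∂π := by
        simp_rw [euclideanSpace_edist_sq]
        exact (lintegral_finsetSum _ fun j _ => by fun_prop).symm

lemma lintegral_edist_locationScale_sq {ρ : Measure (EuclideanSpace ℝ ι)} [IsProbabilityMeasure ρ]
    (hρ : MemLp id 2 ρ) (hmean : ∀ j, ∫ x, x j ∂ρ = 0) (hvar : ∀ j, Var[fun x => x j; ρ] = 1)
    (θ θ' : ι ⊕ ι → ℝ) :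
    ∫⁻ x, edist (locationScale θ x) (locationScale θ' x) ^ 2 ∂ρ
      = edist (WithLp.toLp 2 θ) (WithLp.toLp 2 θ') ^ 2 := by
  have hcoord (j : ι) : MemLp (fun x => x j) 2 ρ := hρ.eval_piLp j
  have haffine (m c : ℝ) (j : ι) : MemLp (fun x => m + c * x j) 2 ρ :=
    (memLp_const m).add ((hcoord j).const_mul c)
  have hmean_affine (m c : ℝ) (j : ι) : ∫ x, m + c * x j ∂ρ = m := by
    rw [integral_add (integrable_const _) (((hcoord j).integrable one_le_two).const_mul c),
      integral_const_mul, hmean]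
    simp
  have hvar_sub (m m' c c' : ℝ) (j : ι) :
      Var[(fun x => m + c * x j) - fun x => m' + c' * x j; ρ] = (c - c') ^ 2 := by
    have hdiff : ((fun x : EuclideanSpace ℝ ι => m + c * x j) - fun x => m' + c' * x j)
        = fun x => (m - m') + (c - c') * x j := by
      funext x
      simp only [Pi.sub_apply]
      ring
    rw [hdiff, variance_const_add ((hcoord j).const_mul _).1, variance_const_mul, hvar, mul_one]
  simp_rw [euclideanSpace_edist_sq, Fintype.sum_sum_type, ← Finset.sum_add_distrib]
  simp only [locationScale]
  rw [lintegral_finsetSum _ fun j _ => by fun_prop]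
  refine Finset.sum_congr rfl fun j _ => ?_
  rw [lintegral_edist_sq (haffine _ _ j) (haffine _ _ j), hmean_affine, hmean_affine, hvar_sub,
    edist_sq_eq_ofReal, edist_sq_eq_ofReal, ← ENNReal.ofReal_add (sq_nonneg _) (sq_nonneg _)]

end Moments

section Gaussian

variable {k : ℕ}

/-- The parameter vector with nonnegative standard deviations of the law `gaussLaw θ`: a negative
entry `σ_j` stands for the same law as `|σ_j|`. -/
def absSd (θ : GaussParam k) : GaussParam k :=
  Sum.elim (fun j => θ (Sum.inl j)) fun j => |θ (Sum.inr j)|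

lemma absSd_eq_self {θ : GaussParam k} (hθ : ∀ j, 0 ≤ θ (Sum.inr j)) : absSd θ = θ := by
  ext (j | j)
  · rfl
  · exact abs_of_nonneg (hθ j)

lemma measurable_absSd : Measurable (absSd : GaussParam k → GaussParam k) := by
  refine measurable_pi_lambda _ ?_
  rintro (j | j) <;> simp only [absSd, Sum.elim_inl, Sum.elim_inr] <;> fun_prop

instance isProbabilityMeasure_gaussLaw (θ : GaussParam k) : IsProbabilityMeasure (gaussLaw θ) := by
  unfold gaussLaw
  infer_instance

lemma memLp_id_gaussLaw (θ : GaussParam k) : MemLp id 2 (gaussLaw θ) := by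
  unfold gaussLaw
  exact IsGaussian.memLp_two_id

lemma gaussLaw_absSd (θ : GaussParam k) : gaussLaw (absSd θ) = gaussLaw θ := by
  simp [gaussLaw, absSd]

open scoped MatrixOrder in
lemma gaussLaw_eq_map_stdGaussian {θ : GaussParam k} (hθ : ∀ j, 0 ≤ θ (Sum.inr j)) :
    gaussLaw θ = (stdGaussian (EuclideanSpace ℝ (Fin k))).map (locationScale θ) := by
  have hsqrt : CFC.sqrt (Matrix.diagonal fun j => θ (Sum.inr j) ^ 2)
      = Matrix.diagonal fun j => θ (Sum.inr j) := by
    refine CFC.sqrt_unique ?_ (Matrix.PosSemidef.diagonal hθ).nonneg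
    simp [Matrix.diagonal_mul_diagonal, sq]
  rw [gaussLaw, multivariateGaussian, hsqrt]
  congr 1
  ext x j
  simp [locationScale, Matrix.mulVec_diagonal]

lemma stdGaussian_eq_gaussLaw :
    stdGaussian (EuclideanSpace ℝ (Fin k))
      = gaussLaw (Sum.elim (0 : Fin k → ℝ) (1 : Fin k → ℝ)) := by
  have hmean : WithLp.toLp 2 (fun j => Sum.elim (0 : Fin k → ℝ) (1 : Fin k → ℝ) (Sum.inl j))
      = (0 : EuclideanSpace ℝ (Fin k)) := rfl
  rw [gaussLaw, hmean, ← multivariateGaussian_zero_one]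
  simp

lemma hasLaw_eval_gaussLaw (θ : GaussParam k) (j : Fin k) :
    HasLaw (fun x => x j) (gaussianReal (θ (Sum.inl j)) (θ (Sum.inr j) ^ 2).toNNReal)
      (gaussLaw θ) := by
  have hS : (Matrix.diagonal fun j => θ (Sum.inr j) ^ 2).PosSemidef :=
    Matrix.PosSemidef.diagonal fun j => sq_nonneg _
  simpa [gaussLaw] using (measurePreserving_eval_multivariateGaussian
    (μ := WithLp.toLp 2 fun j => θ (Sum.inl j)) hS (i := j)).hasLaw

lemma integral_eval_gaussLaw (θ : GaussParam k) (j : Fin k) :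
    ∫ x, x j ∂(gaussLaw θ) = θ (Sum.inl j) :=
  (hasLaw_eval_gaussLaw θ j).integral_eq.trans integral_id_gaussianReal

lemma variance_eval_gaussLaw (θ : GaussParam k) (j : Fin k) :
    Var[fun x => x j; gaussLaw θ] = θ (Sum.inr j) ^ 2 := by
  rw [(hasLaw_eval_gaussLaw θ j).variance_eq, variance_id_gaussianReal,
    Real.coe_toNNReal _ (sq_nonneg _)]

lemma meanSd_gaussLaw (θ : GaussParam k) : meanSd (gaussLaw θ) = WithLp.toLp 2 (absSd θ) := by
  simp [meanSd, absSd, integral_eval_gaussLaw, variance_eval_gaussLaw, Real.sqrt_sq_eq_abs]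

theorem wasserstein2_gaussLaw (θ θ' : GaussParam k) :
    wasserstein2 (gaussLaw θ) (gaussLaw θ')
      = edist (WithLp.toLp 2 (absSd θ)) (WithLp.toLp 2 (absSd θ')) := by
  have habs_nonneg (θ : GaussParam k) (j : Fin k) : 0 ≤ absSd θ (Sum.inr j) := abs_nonneg _
  refine le_antisymm ((ENNReal.pow_le_pow_left_iff two_ne_zero).1 ?_) ?_
  · rw [← gaussLaw_absSd θ, ← gaussLaw_absSd θ', gaussLaw_eq_map_stdGaussian (habs_nonneg θ),
      gaussLaw_eq_map_stdGaussian (habs_nonneg θ'), stdGaussian_eq_gaussLaw]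
    refine (sq_wasserstein2_map_map_le _ (measurable_locationScale _)
      (measurable_locationScale _)).trans_eq (lintegral_edist_locationScale_sq
        (memLp_id_gaussLaw _) (fun j => ?_) (fun j => ?_) _ _)
    · rw [integral_eval_gaussLaw, Sum.elim_inl, Pi.zero_apply]
    · rw [variance_eval_gaussLaw, Sum.elim_inr, Pi.one_apply, one_pow]
  · rw [← meanSd_gaussLaw, ← meanSd_gaussLaw]
    exact edist_meanSd_le_wasserstein2 (memLp_id_gaussLaw θ) (memLp_id_gaussLaw θ')

end Gaussian

/-! ### Resampling a uniform variable inside the cells of a grid -/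

section Grid

/-- The left endpoint of the cell `[lo + n s, lo + (n + 1) s)`, `n : ℤ`, that contains `x`. -/
noncomputable def gridFloor (lo s x : ℝ) : ℝ := lo + ⌊(x - lo) / s⌋ * s

lemma measurable_gridFloor (lo s : ℝ) : Measurable (gridFloor lo s) := by
  unfold gridFloor
  fun_prop

variable {lo s x : ℝ}

lemma gridFloor_eq_of_mem_Ico (hs : 0 < s) {n : ℤ}
    (hx : x ∈ Set.Ico (lo + n * s) (lo + n * s + s)) : gridFloor lo s x = lo + n * s := by
  have hfloor : ⌊(x - lo) / s⌋ = n := by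
    rw [Int.floor_eq_iff, le_div_iff₀ hs, div_lt_iff₀ hs]
    constructor <;> linarith [hx.1, hx.2]
  rw [gridFloor, hfloor]

lemma gridFloor_gridFloor_add (hs : 0 < s) {u : ℝ} (hu : u ∈ Set.Ico 0 s) :
    gridFloor lo s (gridFloor lo s x + u) = gridFloor lo s x :=
  gridFloor_eq_of_mem_Ico hs (by simpa [gridFloor] using hu)

lemma mem_Ico_gridFloor (hs : 0 < s) (lo x : ℝ) :
    x ∈ Set.Ico (gridFloor lo s x) (gridFloor lo s x + s) := by
  have hle := (le_div_iff₀ hs).1 (Int.floor_le ((x - lo) / s))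
  have hlt := (div_lt_iff₀ hs).1 (Int.lt_floor_add_one ((x - lo) / s))
  constructor <;> simp only [gridFloor] <;> linarith

lemma le_gridFloor (hs : 0 ≤ s) (hx : lo ≤ x) : lo ≤ gridFloor lo s x := by
  have hfloor : (0 : ℝ) ≤ ⌊(x - lo) / s⌋ := by
    exact_mod_cast Int.floor_nonneg.2 (div_nonneg (sub_nonneg.2 hx) hs)
  exact le_add_of_nonneg_right (mul_nonneg hfloor hs)

lemma isProbabilityMeasure_cond_Ioo (hs : 0 < s) :
    IsProbabilityMeasure (cond (volume : Measure ℝ) (Set.Ioo 0 s)) :=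
  cond_isProbabilityMeasure_of_finite (by simpa using hs) (by simp)

lemma map_const_add_cond_Ioo (a s : ℝ) :
    (cond volume (Set.Ioo 0 s)).map (a + ·)
      = (ENNReal.ofReal s)⁻¹ • volume.restrict (Set.Ico a (a + s)) := by
  have hpre : (a + ·) ⁻¹' Set.Ioo a (a + s) = Set.Ioo 0 s := by simp
  rw [ProbabilityTheory.cond, Measure.map_smul, Real.volume_Ioo, sub_zero, ← hpre,
    ((measurePreserving_add_left volume a).restrict_preimage measurableSet_Ioo).map_eq,
    restrict_Ioo_eq_restrict_Ico]

lemma map_resample_restrict_cell (hs : 0 < s) (lo : ℝ) (n : ℤ) :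
    ((volume.restrict (Set.Ico (lo + n * s) (lo + n * s + s))).prod
        (cond volume (Set.Ioo 0 s))).map (fun p => gridFloor lo s p.1 + p.2)
      = volume.restrict (Set.Ico (lo + n * s) (lo + n * s + s)) := by
  have := isProbabilityMeasure_cond_Ioo hs
  have hcell : (fun p : ℝ × ℝ => gridFloor lo s p.1 + p.2)
      =ᵐ[(volume.restrict (Set.Ico (lo + n * s) (lo + n * s + s))).prod
        (cond volume (Set.Ioo 0 s))] fun p => (lo + n * s) + p.2 := by
    filter_upwards [Measure.quasiMeasurePreserving_fst.ae (ae_restrict_mem measurableSet_Ico)]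
      with p hp
    rw [gridFloor_eq_of_mem_Ico hs hp]
  have hsnd : (fun p : ℝ × ℝ => (lo + n * s) + p.2) = ((lo + n * s) + ·) ∘ Prod.snd := rfl
  rw [Measure.map_congr hcell, hsnd, ← Measure.map_map (measurable_const_add _) measurable_snd,
    Measure.map_snd_prod, Measure.map_smul, map_const_add_cond_Ioo, smul_smul]
  simp [ENNReal.mul_inv_cancel, hs]

lemma map_resample_restrict_Ico (hs : 0 < s) (lo : ℝ) (m : ℕ) :
    ((volume.restrict (Set.Ico lo (lo + m * s))).prod (cond volume (Set.Ioo 0 s))).map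
        (fun p => gridFloor lo s p.1 + p.2)
      = volume.restrict (Set.Ico lo (lo + m * s)) := by
  have := isProbabilityMeasure_cond_Ioo hs
  induction m with
  | zero => simp
  | succ m ih =>
    have hmeas : Measurable fun p : ℝ × ℝ => gridFloor lo s p.1 + p.2 :=
      ((measurable_gridFloor lo s).comp measurable_fst).add measurable_snd
    have hsplit : volume.restrict (Set.Ico lo (lo + (m + 1 : ℕ) * s))
        = volume.restrict (Set.Ico lo (lo + m * s))
          + volume.restrict (Set.Ico (lo + (m : ℤ) * s) (lo + (m : ℤ) * s + s)) := by
      have hm : (0 : ℝ) ≤ m * s := by positivity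
      rw [Int.cast_natCast, ← Measure.restrict_union Set.Ico_disjoint_Ico_same measurableSet_Ico,
        Set.Ico_union_Ico_eq_Ico (by linarith) (by linarith)]
      push_cast
      ring_nf
    rw [hsplit, Measure.add_prod, Measure.map_add _ _ hmeas, ih, map_resample_restrict_cell hs]

lemma measurePreserving_resample (hs : 0 < s) (lo : ℝ) (m : ℕ) :
    MeasurePreserving (fun p : ℝ × ℝ => gridFloor lo s p.1 + p.2)
      ((cond volume (Set.Icc lo (lo + m * s))).prod (cond volume (Set.Ioo 0 s)))
      (cond volume (Set.Icc lo (lo + m * s))) := by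
  refine ⟨((measurable_gridFloor lo s).comp measurable_fst).add measurable_snd, ?_⟩
  have hcond : cond volume (Set.Icc lo (lo + m * s))
      = (volume (Set.Icc lo (lo + m * s)))⁻¹ • volume.restrict (Set.Ico lo (lo + m * s)) := by
    rw [ProbabilityTheory.cond, restrict_Ico_eq_restrict_Icc]
  rw [hcond, Measure.prod_smul_left, Measure.map_smul, map_resample_restrict_Ico hs]

end Grid

section Noise

variable {d : ℕ} {s : Fin d → ℝ}

lemma isProbabilityMeasure_quantizeNoise (hs : ∀ i, 0 < s i) :
    IsProbabilityMeasure (quantizeNoise s) := by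
  have (i : Fin d) := isProbabilityMeasure_cond_Ioo (hs i)
  unfold quantizeNoise
  infer_instance

lemma ae_quantizeNoise_mem (hs : ∀ i, 0 < s i) :
    ∀ᵐ u ∂(quantizeNoise s), ∀ i, u i ∈ Set.Ioo 0 (s i) := by
  have (i : Fin d) := isProbabilityMeasure_cond_Ioo (hs i)
  exact Filter.eventually_all.2 fun i =>
    Measure.tendsto_eval_ae_ae.eventually (ae_cond_mem measurableSet_Ioo)

lemma measurePreserving_resample_pi (hs : ∀ i, 0 < s i) (lo : Fin d → ℝ) (m : Fin d → ℕ) :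
    MeasurePreserving
      (fun (p : (Fin d → ℝ) × (Fin d → ℝ)) i => gridFloor (lo i) (s i) (p.1 i) + p.2 i)
      ((Measure.pi fun i => cond volume (Set.Icc (lo i) (lo i + m i * s i))).prod
        (quantizeNoise s))
      (Measure.pi fun i => cond volume (Set.Icc (lo i) (lo i + m i * s i))) := by
  let U (i : Fin d) : Measure ℝ := cond volume (Set.Icc (lo i) (lo i + m i * s i))
  let N (i : Fin d) : Measure ℝ := cond volume (Set.Ioo 0 (s i))
  have hcoord : MeasurePreserving
      (fun (p : Fin d → ℝ × ℝ) i => gridFloor (lo i) (s i) (p i).1 + (p i).2)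
      (Measure.pi fun i => (U i).prod (N i)) (Measure.pi U) :=
    measurePreserving_pi (fun i => (U i).prod (N i)) U
      fun i => measurePreserving_resample (hs i) (lo i) (m i)
  have harrow : MeasurePreserving (fun (p : (Fin d → ℝ) × (Fin d → ℝ)) i => (p.1 i, p.2 i))
      ((Measure.pi U).prod (Measure.pi N)) (Measure.pi fun i => (U i).prod (N i)) :=
    (measurePreserving_arrowProdEquivProdArrow ℝ ℝ (Fin d) U N).symm
  exact (hcoord.comp harrow :)

end Noise

/-! ### Invariance of the prior under quantization -/

lemma measurePreserving_prod_right_comm {α β γ : Type*} [MeasurableSpace α] [MeasurableSpace β]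
    [MeasurableSpace γ] (μ : Measure α) (ν : Measure β) (τ : Measure γ) [SFinite μ] [SFinite ν]
    [SFinite τ] :
    MeasurePreserving (fun p : (α × β) × γ => ((p.1.1, p.2), p.1.2))
      ((μ.prod ν).prod τ) ((μ.prod τ).prod ν) :=
  ((measurePreserving_prodAssoc μ τ ν).symm).comp
    (((MeasurePreserving.id μ).prod Measure.measurePreserving_swap).comp
      (measurePreserving_prodAssoc μ ν τ))

section Prior

variable {k d : ℕ} {g : Fin d → Fin k ⊕ Fin k} {lo hi s : Fin d → ℝ} {P : Measure (GaussParam k)}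

lemma quantizeParam_secret (hg : Function.Injective g) (θ : GaussParam k) (u : Fin d → ℝ)
    (i : Fin d) : quantizeParam g lo s θ u (g i) = gridFloor (lo i) (s i) (θ (g i)) + u i := by
  rw [quantizeParam, hg.extend_apply, gridFloor]

lemma quantizeParam_nonsecret {j : Fin k ⊕ Fin k} (hj : j ∉ Set.range g) (θ : GaussParam k)
    (u : Fin d → ℝ) : quantizeParam g lo s θ u j = θ j := by
  rw [quantizeParam, Function.extend_apply' _ _ _ (by simpa using hj)]

lemma measurable_quantizeParam_right (g : Fin d → Fin k ⊕ Fin k) (lo s : Fin d → ℝ)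
    (θ : GaussParam k) : Measurable (quantizeParam g lo s θ) :=
  Measurable.of_uncurry_left (f := quantizeParam g lo s) (measurable_quantizeParam g lo s)

lemma gridFloor_quantizeParam (hg : Function.Injective g) (hs : ∀ i, 0 < s i) (θ : GaussParam k)
    {v : Fin d → ℝ} (hv : ∀ i, v i ∈ Set.Ioo 0 (s i)) (i : Fin d) :
    gridFloor (lo i) (s i) (quantizeParam g lo s θ v (g i))
      = gridFloor (lo i) (s i) (θ (g i)) := by
  rw [quantizeParam_secret hg, gridFloor_gridFloor_add (hs i) (Set.Ioo_subset_Ico_self (hv i))]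

lemma quantizeParam_quantizeParam (hg : Function.Injective g) (hs : ∀ i, 0 < s i)
    (θ : GaussParam k) {v : Fin d → ℝ} (hv : ∀ i, v i ∈ Set.Ioo 0 (s i)) (u : Fin d → ℝ) :
    quantizeParam g lo s (quantizeParam g lo s θ v) u = quantizeParam g lo s θ u := by
  ext j
  by_cases hj : j ∈ Set.range g
  · obtain ⟨i, rfl⟩ := hj
    rw [quantizeParam_secret hg, gridFloor_quantizeParam hg hs θ hv, quantizeParam_secret hg]
  · simp only [quantizeParam_nonsecret hj]

lemma measurableEmbedding_secrets_nonsecrets (g : Fin d → Fin k ⊕ Fin k) :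
    MeasurableEmbedding fun θ : GaussParam k =>
      ((fun i => θ (g i)), fun j : {j // j ∉ Set.range g} => θ j) := by
  refine Measurable.measurableEmbedding (by fun_prop) fun θ θ' h => ?_
  obtain ⟨hsecret, hnonsecret⟩ := Prod.ext_iff.1 h
  ext j
  by_cases hj : j ∈ Set.range g
  · obtain ⟨i, rfl⟩ := hj
    exact congrFun hsecret i
  · exact congrFun hnonsecret ⟨j, hj⟩

lemma UniformSecretsPrior.map_secrets (hP : UniformSecretsPrior P g lo hi) :
    P.map (fun θ i => θ (g i)) = Measure.pi fun i => cond volume (Set.Icc (lo i) (hi i)) := by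
  have := hP.isProbabilityMeasure
  rw [(iIndepFun_iff_map_fun_eq_pi_map fun i => (measurable_pi_apply (g i)).aemeasurable).1
    hP.indep]
  exact congrArg Measure.pi (funext hP.uniform)

lemma UniformSecretsPrior.measurePreserving_secrets_nonsecrets
    (hP : UniformSecretsPrior P g lo hi) :
    MeasurePreserving (fun θ => ((fun i => θ (g i)), fun j : {j // j ∉ Set.range g} => θ j)) P
      ((Measure.pi fun i => cond volume (Set.Icc (lo i) (hi i))).prod
        (P.map fun θ (j : {j // j ∉ Set.range g}) => θ j)) := by
  have := hP.isProbabilityMeasure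
  have hsecrets : Measurable fun (θ : GaussParam k) i => θ (g i) := by fun_prop
  have hnonsecrets : Measurable fun (θ : GaussParam k) (j : {j // j ∉ Set.range g}) => θ j := by
    fun_prop
  refine ⟨hsecrets.prodMk hnonsecrets, ?_⟩
  rw [hP.indep_nonsecret.map_prod_eq_prod_map_map hsecrets.aemeasurable hnonsecrets.aemeasurable,
    hP.map_secrets]

theorem UniformSecretsPrior.measurePreserving_quantizeParam (hg : Function.Injective g)
    (hs : ∀ i, 0 < s i) {m : Fin d → ℕ}
    (hP : UniformSecretsPrior P g lo fun i => lo i + m i * s i) :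
    MeasurePreserving (fun p : GaussParam k × (Fin d → ℝ) => quantizeParam g lo s p.1 p.2)
      (P.prod (quantizeNoise s)) P := by
  have := hP.isProbabilityMeasure
  have := isProbabilityMeasure_quantizeNoise hs
  let S : GaussParam k → Fin d → ℝ := fun θ i => θ (g i)
  let R : GaussParam k → {j // j ∉ Set.range g} → ℝ := fun θ j => θ j
  let U : Measure (Fin d → ℝ) := Measure.pi fun i => cond volume (Set.Icc (lo i) (lo i + m i * s i))
  have hsplit : MeasurePreserving (fun θ => (S θ, R θ)) P (U.prod (P.map R)) :=
    hP.measurePreserving_secrets_nonsecrets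
  have hresample : MeasurePreserving
      (fun (p : (Fin d → ℝ) × (Fin d → ℝ)) i => gridFloor (lo i) (s i) (p.1 i) + p.2 i)
      (U.prod (quantizeNoise s)) U :=
    measurePreserving_resample_pi hs lo m
  have hsplit_quantize : MeasurePreserving
      (fun p => (S (quantizeParam g lo s p.1 p.2), R (quantizeParam g lo s p.1 p.2)))
      (P.prod (quantizeNoise s)) (U.prod (P.map R)) := by
    convert (hresample.prod (MeasurePreserving.id (P.map R))).comp
      ((measurePreserving_prod_right_comm U (P.map R) (quantizeNoise s)).comp
        (hsplit.prod (MeasurePreserving.id (quantizeNoise s)))) using 1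
    ext p j
    · exact quantizeParam_secret hg p.1 p.2 j
    · exact quantizeParam_nonsecret j.2 p.1 p.2
  have hmeas := measurable_quantizeParam g lo s
  refine ⟨hmeas, (measurableEmbedding_secrets_nonsecrets g).map_injective ?_⟩
  rw [Measure.map_map (measurableEmbedding_secrets_nonsecrets g).measurable hmeas]
  exact hsplit_quantize.map_eq.trans hsplit.map_eq.symm

end Prior

/-! ### Union privacy of the quantization mechanism -/

section Privacy

lemma lintegral_measure_section_comm {α β : Type*} [MeasurableSpace α] [MeasurableSpace β]
    (μ : Measure α) (ν : Measure β) [SFinite μ] [SFinite ν] {T : Set (α × β)}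
    (hT : MeasurableSet T) :
    ∫⁻ x, ν {y | (x, y) ∈ T} ∂μ = ∫⁻ y, μ {x | (x, y) ∈ T} ∂ν :=
  (Measure.prod_apply hT).symm.trans (Measure.prod_apply_symm hT)

section Resample

variable {Θ V : Type*} [MeasurableSpace Θ] [MeasurableSpace V] {P : Measure Θ}
  {N : Measure V} [SFinite N] {q : Θ → V → Θ}

lemma lintegral_resample (hq : MeasurePreserving (fun p : Θ × V => q p.1 p.2) (P.prod N) P)
    (hqq : ∀ θ, ∀ᵐ v ∂N, ∀ u, q (q θ v) u = q θ u) {f : Θ → Θ → ℝ≥0∞}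
    (hf : Measurable (Function.uncurry f)) :
    ∫⁻ θ, ∫⁻ u, f θ (q θ u) ∂N ∂P = ∫⁻ θ, ∫⁻ u, ∫⁻ v, f (q θ v) (q θ u) ∂N ∂N ∂P := by
  have hqθ (θ : Θ) : Measurable (q θ) := hq.measurable.comp measurable_prodMk_left
  have hmean : Measurable fun θ => ∫⁻ u, f θ (q θ u) ∂N :=
    (hf.comp (measurable_fst.prodMk hq.measurable)).lintegral_prod_right'
  calc ∫⁻ θ, ∫⁻ u, f θ (q θ u) ∂N ∂P
      = ∫⁻ p, ∫⁻ u, f (q p.1 p.2) (q (q p.1 p.2) u) ∂N ∂(P.prod N) :=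
        (hq.lintegral_comp hmean).symm
    _ = ∫⁻ θ, ∫⁻ v, ∫⁻ u, f (q θ v) (q (q θ v) u) ∂N ∂N ∂P :=
        lintegral_prod _ (hmean.comp hq.measurable).aemeasurable
    _ = ∫⁻ θ, ∫⁻ v, ∫⁻ u, f (q θ v) (q θ u) ∂N ∂N ∂P :=
        lintegral_congr fun θ => lintegral_congr_ae <| (hqq θ).mono fun v hv =>
          lintegral_congr fun u => congrArg (f (q θ v)) (hv u)
    _ = ∫⁻ θ, ∫⁻ u, ∫⁻ v, f (q θ v) (q θ u) ∂N ∂N ∂P :=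
        lintegral_congr fun θ => lintegral_lintegral_swap
          (hf.comp (((hqθ θ).comp measurable_fst).prodMk
            ((hqθ θ).comp measurable_snd))).aemeasurable

/-- An observer of `q θ u` cannot distinguish `θ` from the resampled parameter `q θ v`. -/
lemma lintegral_kernel_resample {G : Type*} [MeasurableSpace G]
    (hq : MeasurePreserving (fun p : Θ × V => q p.1 p.2) (P.prod N) P)
    (hqq : ∀ θ, ∀ᵐ v ∂N, ∀ u, q (q θ v) u = q θ u) {R : Θ → Set G}
    (hR : MeasurableSet {p : Θ × G | p.2 ∈ R p.1}) (A : Kernel Θ G) [IsSFiniteKernel A] :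
    ∫⁻ θ, ∫⁻ u, A (q θ u) (R θ) ∂N ∂P
      = ∫⁻ θ, ∫⁻ u, ∫⁻ y, N {v | y ∈ R (q θ v)} ∂(A (q θ u)) ∂N ∂P := by
  have hqθ (θ : Θ) : Measurable (q θ) := hq.measurable.comp measurable_prodMk_left
  have hA : Measurable fun p : Θ × Θ => A p.2 (R p.1) := by
    have hfst : Measurable fun p : (Θ × Θ) × G => (p.1.1, p.2) := by fun_prop
    exact Kernel.measurable_kernel_prodMk_left (κ := A.comap Prod.snd measurable_snd) (hfst hR)
  rw [lintegral_resample hq hqq (f := fun θ θ' => A θ' (R θ)) hA]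
  refine lintegral_congr fun θ => lintegral_congr fun u => ?_
  exact lintegral_measure_section_comm N (A (q θ u)) (T := {p | p.2 ∈ R (q θ p.1)})
    ((((hqθ θ).comp measurable_fst).prodMk measurable_snd) hR)

end Resample

lemma pi_exists_mem {ι : Type*} [Fintype ι] {α : ι → Type*} [∀ i, MeasurableSpace (α i)]
    (μ : ∀ i, Measure (α i)) [∀ i, IsProbabilityMeasure (μ i)] {B : ∀ i, Set (α i)}
    (hB : ∀ i, MeasurableSet (B i)) :
    Measure.pi μ {v | ∃ i, v i ∈ B i} = ENNReal.ofReal (1 - ∏ i, (1 - (μ i).real (B i))) := by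
  have hbox : MeasurableSet (Set.univ.pi fun i => (B i)ᶜ) :=
    MeasurableSet.univ_pi fun i => (hB i).compl
  have hcompl : {v : ∀ i, α i | ∃ i, v i ∈ B i} = (Set.univ.pi fun i => (B i)ᶜ)ᶜ := by
    ext v; simp
  rw [hcompl, ← ofReal_measureReal, probReal_compl_eq_one_sub hbox]
  congr 2
  rw [measureReal_def, Measure.pi_pi, ENNReal.toReal_prod]
  exact Finset.prod_congr rfl fun i _ => probReal_compl_eq_one_sub (hB i)

lemma setOf_abs_sub_le_eq_Icc (a ε : ℝ) : {v : ℝ | |a - v| ≤ ε} = Set.Icc (a - ε) (a + ε) := by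
  ext v
  rw [Set.mem_ofPred_eq, abs_le, Set.mem_Icc]
  constructor <;> rintro ⟨hlower, hupper⟩ <;> constructor <;> linarith

section Window

variable {s ε : ℝ}

lemma cond_Ioo_real (hs : 0 ≤ s) (B : Set ℝ) :
    (cond volume (Set.Ioo 0 s)).real B = volume.real (Set.Ioo 0 s ∩ B) / s := by
  rw [measureReal_def, cond_apply measurableSet_Ioo, ENNReal.toReal_mul, Real.volume_Ioo,
    sub_zero, ENNReal.toReal_inv, ENNReal.toReal_ofReal hs, inv_mul_eq_div, measureReal_def]

lemma cond_Ioo_real_abs_sub_le (hε : 0 ≤ ε) (hs : 0 ≤ s) (a : ℝ) :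
    (cond volume (Set.Ioo 0 s)).real {v | |a - v| ≤ ε} ≤ 2 * ε / s := by
  rw [cond_Ioo_real hs, setOf_abs_sub_le_eq_Icc]
  gcongr
  calc volume.real (Set.Ioo 0 s ∩ Set.Icc (a - ε) (a + ε))
      ≤ volume.real (Set.Icc (a - ε) (a + ε)) :=
        measureReal_mono Set.inter_subset_right measure_Icc_lt_top.ne
    _ = 2 * ε := by rw [Real.volume_real_Icc_of_le (by linarith)]; ring

lemma cond_Ioo_real_abs_sub_eq {a : ℝ} (hε : 0 ≤ ε) (hεa : ε ≤ a) (has : a + ε ≤ s) :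
    (cond volume (Set.Ioo 0 s)).real {v | |a - v| ≤ ε} = 2 * ε / s := by
  have hIcc : (Set.Ioo 0 s ∩ Set.Icc (a - ε) (a + ε) : Set ℝ)
      =ᵐ[volume] Set.Icc (a - ε) (a + ε) := by
    have h := (Ioo_ae_eq_Icc (μ := volume) (a := (0 : ℝ)) (b := s)).inter
      (Filter.EventuallyEq.refl _ (Set.Icc (a - ε) (a + ε)))
    rwa [Set.inter_eq_right.2 (Set.Icc_subset_Icc (by linarith) (by linarith))] at h
  rw [cond_Ioo_real (by linarith), setOf_abs_sub_le_eq_Icc, measureReal_congr hIcc,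
    Real.volume_real_Icc_of_le (by linarith)]
  ring_nf

end Window

lemma measurableSet_exists_abs_sub_le {ι : Type*} [Countable ι] (ε : ι → ℝ) :
    MeasurableSet {p : (ι → ℝ) × (ι → ℝ) | ∃ i, |p.2 i - p.1 i| ≤ ε i} := by
  simp only [Set.ofPred_exists]
  exact MeasurableSet.iUnion fun i => measurableSet_le (by fun_prop) measurable_const

section NoiseWindow

variable {d : ℕ} {s ε : Fin d → ℝ}

lemma quantizeNoise_exists_abs_sub_le_eq_one_sub_prod (hs : ∀ i, 0 < s i) (ε a : Fin d → ℝ) :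
    quantizeNoise s {v | ∃ i, |a i - v i| ≤ ε i}
      = ENNReal.ofReal
          (1 - ∏ i, (1 - (cond volume (Set.Ioo 0 (s i))).real {v | |a i - v| ≤ ε i})) := by
  have (i : Fin d) := isProbabilityMeasure_cond_Ioo (hs i)
  exact pi_exists_mem _ (B := fun i => {v | |a i - v| ≤ ε i})
    fun i => measurableSet_le (by fun_prop) measurable_const

lemma quantizeNoise_exists_abs_sub_le_le (hε : ∀ i, 0 < ε i) (hεs : ∀ i, 2 * ε i < s i)
    (a : Fin d → ℝ) :
    quantizeNoise s {v | ∃ i, |a i - v i| ≤ ε i}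
      ≤ ENNReal.ofReal (1 - ∏ i, (1 - 2 * ε i / s i)) := by
  have hs (i : Fin d) : 0 < s i := by linarith [hε i, hεs i]
  rw [quantizeNoise_exists_abs_sub_le_eq_one_sub_prod hs]
  refine ENNReal.ofReal_le_ofReal (sub_le_sub_left
    (Finset.prod_le_prod (fun i _ => ?_) fun i _ => ?_) _)
  · rw [sub_nonneg, div_le_one (hs i)]
    exact (hεs i).le
  · exact sub_le_sub_left (cond_Ioo_real_abs_sub_le (hε i).le (hs i).le _) _

lemma quantizeNoise_exists_abs_sub_le_eq (hε : ∀ i, 0 < ε i) {a : Fin d → ℝ}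
    (hεa : ∀ i, ε i ≤ a i) (has : ∀ i, a i + ε i ≤ s i) :
    quantizeNoise s {v | ∃ i, |a i - v i| ≤ ε i}
      = ENNReal.ofReal (1 - ∏ i, (1 - 2 * ε i / s i)) := by
  have hs (i : Fin d) : 0 < s i := by linarith [hε i, hεa i, has i]
  simp_rw [quantizeNoise_exists_abs_sub_le_eq_one_sub_prod hs,
    fun i => cond_Ioo_real_abs_sub_eq (hε i).le (hεa i) (has i)]

end NoiseWindow

variable {k d : ℕ} {g : Fin d → Fin k ⊕ Fin k} {lo s ε : Fin d → ℝ} {m : Fin d → ℕ}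
  {P : Measure (GaussParam k)}

/-- Given the released parameter, every secret is uniformly distributed in its cell. -/
lemma lintegral_attack_quantizationMechanism (hg : Function.Injective g) (hs : ∀ i, 0 < s i)
    (hP : UniformSecretsPrior P g lo fun i => lo i + m i * s i)
    (A : Kernel (GaussParam k) (Fin d → ℝ)) [IsMarkovKernel A] :
    ∫⁻ θ, ∫⁻ θ', A θ' {guess | ∃ i, |guess i - θ (g i)| ≤ ε i}
        ∂(quantizationMechanism g lo s θ) ∂P
      = ∫⁻ θ, ∫⁻ u, ∫⁻ guess, quantizeNoise s
            {v | ∃ i, |(guess i - gridFloor (lo i) (s i) (θ (g i))) - v i| ≤ ε i}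
          ∂(A (quantizeParam g lo s θ u)) ∂(quantizeNoise s) ∂P := by
  have := hP.isProbabilityMeasure
  have := isProbabilityMeasure_quantizeNoise hs
  have hsecrets : Measurable fun p : GaussParam k × (Fin d → ℝ) =>
      ((fun i => p.1 (g i)), p.2) := by fun_prop
  have hset : MeasurableSet {p : GaussParam k × (Fin d → ℝ) | ∃ i, |p.2 i - p.1 (g i)| ≤ ε i} :=
    hsecrets (measurableSet_exists_abs_sub_le ε)
  have hreleased (θ : GaussParam k) := lintegral_map (μ := quantizeNoise s)
    (Kernel.measurable_coe A (measurable_prodMk_left (x := θ) hset))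
    (measurable_quantizeParam_right g lo s θ)
  refine (lintegral_congr hreleased).trans ?_
  simp_rw [sub_sub, ← quantizeParam_secret hg]
  exact lintegral_kernel_resample (hP.measurePreserving_quantizeParam hg hs)
    (fun θ => (ae_quantizeNoise_mem hs).mono fun v hv u =>
      quantizeParam_quantizeParam hg hs θ hv u) hset A

lemma unionPrivacy_quantizationMechanism_le (hg : Function.Injective g) (hε : ∀ i, 0 < ε i)
    (hεs : ∀ i, 2 * ε i < s i) (hP : UniformSecretsPrior P g lo fun i => lo i + m i * s i) :
    unionPrivacy P g ε (quantizationMechanism g lo s)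
      ≤ ENNReal.ofReal (1 - ∏ i, (1 - 2 * ε i / s i)) := by
  have hs (i : Fin d) : 0 < s i := by linarith [hε i, hεs i]
  have := hP.isProbabilityMeasure
  have := isProbabilityMeasure_quantizeNoise hs
  refine iSup₂_le fun A hA => ?_
  rw [lintegral_attack_quantizationMechanism hg hs hP]
  calc _ ≤ ∫⁻ θ, ∫⁻ u, ∫⁻ _, ENNReal.ofReal (1 - ∏ i, (1 - 2 * ε i / s i))
        ∂(A (quantizeParam g lo s θ u)) ∂(quantizeNoise s) ∂P :=
        lintegral_mono fun θ => lintegral_mono fun u => lintegral_mono fun guess =>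
          quantizeNoise_exists_abs_sub_le_le hε hεs _
    _ = _ := by simp

/-- The optimal attack guesses the midpoints of the observed cells. -/
lemma le_unionPrivacy_quantizationMechanism (hg : Function.Injective g) (hε : ∀ i, 0 < ε i)
    (hεs : ∀ i, 2 * ε i < s i) (hP : UniformSecretsPrior P g lo fun i => lo i + m i * s i) :
    ENNReal.ofReal (1 - ∏ i, (1 - 2 * ε i / s i))
      ≤ unionPrivacy P g ε (quantizationMechanism g lo s) := by
  have hs (i : Fin d) : 0 < s i := by linarith [hε i, hεs i]
  have := hP.isProbabilityMeasure
  have := isProbabilityMeasure_quantizeNoise hs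
  have hmid : Measurable fun (θ' : GaussParam k) (i : Fin d) =>
      gridFloor (lo i) (s i) (θ' (g i)) + s i / 2 :=
    measurable_pi_lambda _ fun i =>
      ((measurable_gridFloor _ _).comp (measurable_pi_apply (g i))).add_const _
  refine le_iSup₂_of_le (Kernel.deterministic _ hmid) inferInstance ?_
  rw [lintegral_attack_quantizationMechanism hg hs hP]
  have hsuccess (θ : GaussParam k) : ∀ᵐ u ∂quantizeNoise s,
      ∫⁻ guess, quantizeNoise s
          {v | ∃ i, |(guess i - gridFloor (lo i) (s i) (θ (g i))) - v i| ≤ ε i}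
        ∂(Kernel.deterministic _ hmid (quantizeParam g lo s θ u))
      = ENNReal.ofReal (1 - ∏ i, (1 - 2 * ε i / s i)) := by
    filter_upwards [ae_quantizeNoise_mem hs] with u hu
    rw [Kernel.deterministic_apply, lintegral_dirac]
    simp_rw [gridFloor_quantizeParam hg hs θ hu, add_sub_cancel_left]
    exact quantizeNoise_exists_abs_sub_le_eq hε (fun i => by linarith [hεs i])
      fun i => by linarith [hεs i]
  rw [lintegral_congr fun θ => lintegral_congr_ae (hsuccess θ)]
  simp

theorem unionPrivacy_quantizationMechanism (hg : Function.Injective g) (hε : ∀ i, 0 < ε i)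
    (hεs : ∀ i, 2 * ε i < s i) (hP : UniformSecretsPrior P g lo fun i => lo i + m i * s i) :
    unionPrivacy P g ε (quantizationMechanism g lo s)
      = ENNReal.ofReal (1 - ∏ i, (1 - 2 * ε i / s i)) :=
  (unionPrivacy_quantizationMechanism_le hg hε hεs hP).antisymm
    (le_unionPrivacy_quantizationMechanism hg hε hεs hP)

end Privacy

/-! ### Distortion of the quantization mechanism -/

section Distortion

variable {ι : Type*} [Fintype ι]

lemma mul_sqrt_sum_sq_le {c : ℝ} (hc : 0 ≤ c) {x y : ι → ℝ} (hx : ∀ i, 0 ≤ x i)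
    (hxy : ∀ i, c * x i ≤ |y i|) : c * √(∑ i, x i ^ 2) ≤ √(∑ i, y i ^ 2) := by
  rw [← Real.sqrt_sq hc, ← Real.sqrt_mul (sq_nonneg c), Finset.mul_sum]
  refine Real.sqrt_le_sqrt (Finset.sum_le_sum fun i _ => ?_)
  rw [← mul_pow, ← sq_abs (y i)]
  exact pow_le_pow_left₀ (mul_nonneg hc (hx i)) (hxy i) 2

lemma edist_toLp_two_eq (x y : ι → ℝ) :
    edist (WithLp.toLp 2 x) (WithLp.toLp 2 y) = ENNReal.ofReal √(∑ j, (x j - y j) ^ 2) := by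
  rw [edist_dist, EuclideanSpace.dist_eq]
  simp only [Real.dist_eq, sq_abs]

variable {k d : ℕ} {g : Fin d → Fin k ⊕ Fin k} {lo hi s : Fin d → ℝ} {P : Measure (GaussParam k)}
  {θ θ' : GaussParam k}

lemma wasserstein2_le_distortion {M : Kernel (GaussParam k) (GaussParam k)} (hθ : θ ∈ P.support)
    (hθ' : θ' ∈ (M θ).support) : wasserstein2 (gaussLaw θ) (gaussLaw θ') ≤ distortion P M :=
  le_iSup₂_of_le θ hθ (le_iSup₂_of_le θ' hθ' le_rfl)

lemma UniformSecretsPrior.exists_mem_support (hP : UniformSecretsPrior P g lo hi)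
    (hlohi : ∀ i, lo i < hi i) {b : Fin d → ℝ} (hb : ∀ i, lo i < b i) :
    ∃ θ ∈ P.support, ∀ i, θ (g i) ∈ Set.Icc (lo i) (b i) := by
  have hmeas : MeasurableSet (Set.univ.pi fun i => Set.Icc (lo i) (b i)) :=
    MeasurableSet.univ_pi fun i => measurableSet_Icc
  have hpos : 0 < P ((fun θ i => θ (g i)) ⁻¹' Set.univ.pi fun i => Set.Icc (lo i) (b i)) := by
    rw [← Measure.map_apply (by fun_prop) hmeas, hP.map_secrets, Measure.pi_pi,
      CanonicallyOrderedAdd.prod_pos]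
    intro i _
    rw [cond_apply measurableSet_Icc, Set.Icc_inter_Icc, Real.volume_Icc, Real.volume_Icc]
    exact ENNReal.mul_pos (by simp) (by simp [hlohi i, hb i])
  obtain ⟨θ, hθ, hθP⟩ := Measure.nonempty_inter_support_of_pos hpos
  exact ⟨θ, hθP, fun i => hθ i trivial⟩

lemma UniformSecretsPrior.sd_nonneg_of_mem_support (hP : UniformSecretsPrior P g lo hi)
    (hθ : θ ∈ P.support) (j : Fin k) : 0 ≤ θ (Sum.inr j) :=
  Measure.support_subset_of_isClosed (t := {θ : GaussParam k | 0 ≤ θ (Sum.inr j)})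
    (isClosed_le continuous_const (continuous_apply _)) (hP.sd_nonneg.mono fun _ h => h j) hθ

lemma UniformSecretsPrior.lo_le_of_mem_support (hP : UniformSecretsPrior P g lo hi)
    (hθ : θ ∈ P.support) (i : Fin d) : lo i ≤ θ (g i) := by
  refine Measure.support_subset_of_isClosed (t := {θ : GaussParam k | lo i ≤ θ (g i)})
    (isClosed_le continuous_const (continuous_apply _)) ?_ hθ
  have hle : ∀ᵐ x ∂P.map (fun θ : GaussParam k => θ (g i)), lo i ≤ x := by
    rw [show P.map (fun θ : GaussParam k => θ (g i)) = _ from hP.uniform i]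
    exact (ae_cond_mem measurableSet_Icc).mono fun x hx => hx.1
  exact ae_of_ae_map (measurable_pi_apply (g i)).aemeasurable hle

lemma UniformSecretsPrior.lo_nonneg (hP : UniformSecretsPrior P g lo hi)
    (hlohi : ∀ i, lo i < hi i) {i : Fin d} {j : Fin k} (hij : g i = Sum.inr j) : 0 ≤ lo i := by
  refine le_of_forall_pos_le_add fun δ hδ => ?_
  obtain ⟨θ, hθ, hmem⟩ := hP.exists_mem_support hlohi fun i => lt_add_of_pos_right (lo i) hδ
  have hsd := hP.sd_nonneg_of_mem_support hθ j
  rw [← hij] at hsd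
  exact hsd.trans (hmem i).2

lemma mem_of_mem_support_quantizationMechanism (hs : ∀ i, 0 < s i) {t : Set (GaussParam k)}
    (ht : IsClosed t)
    (hq : ∀ u : Fin d → ℝ, (∀ i, u i ∈ Set.Ioo 0 (s i)) → quantizeParam g lo s θ u ∈ t)
    (hθ' : θ' ∈ (quantizationMechanism g lo s θ).support) : θ' ∈ t := by
  refine Measure.support_subset_of_isClosed ht ?_ hθ'
  exact (ae_map_iff (measurable_quantizeParam_right g lo s θ).aemeasurable ht.measurableSet).2
    ((ae_quantizeNoise_mem hs).mono hq)

lemma secret_mem_Icc_of_mem_support_quantizationMechanism (hg : Function.Injective g)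
    (hs : ∀ i, 0 < s i) (hθ' : θ' ∈ (quantizationMechanism g lo s θ).support) (i : Fin d) :
    θ' (g i) ∈ Set.Icc (gridFloor (lo i) (s i) (θ (g i)))
      (gridFloor (lo i) (s i) (θ (g i)) + s i) := by
  refine mem_of_mem_support_quantizationMechanism hs (t := {θ' | θ' (g i) ∈ Set.Icc _ _})
    (isClosed_Icc.preimage (continuous_apply (g i))) (fun u hu => ?_) hθ'
  rw [Set.mem_ofPred_eq, quantizeParam_secret hg]
  exact ⟨by linarith [(hu i).1], by linarith [(hu i).2]⟩

lemma nonsecret_eq_of_mem_support_quantizationMechanism (hs : ∀ i, 0 < s i)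
    (hθ' : θ' ∈ (quantizationMechanism g lo s θ).support) {j : Fin k ⊕ Fin k}
    (hj : j ∉ Set.range g) : θ' j = θ j :=
  mem_of_mem_support_quantizationMechanism hs (t := {θ' | θ' j = θ j})
    (isClosed_eq (continuous_apply j) continuous_const)
    (fun u _ => quantizeParam_nonsecret hj θ u) hθ'

lemma exists_mem_support_quantizationMechanism (hg : Function.Injective g) (hs : ∀ i, 0 < s i)
    (θ : GaussParam k) {b : Fin d → ℝ} (hb : ∀ i, b i < s i) :
    ∃ θ' ∈ (quantizationMechanism g lo s θ).support,
      ∀ i, gridFloor (lo i) (s i) (θ (g i)) + b i ≤ θ' (g i) := by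
  have (i : Fin d) := isProbabilityMeasure_cond_Ioo (hs i)
  let B : Set (GaussParam k) := {θ' | ∀ i, gridFloor (lo i) (s i) (θ (g i)) + b i ≤ θ' (g i)}
  have hB : MeasurableSet B := by
    simp only [B, Set.ofPred_forall]
    exact MeasurableSet.iInter fun i => measurableSet_le measurable_const (measurable_pi_apply _)
  have hpre : quantizeParam g lo s θ ⁻¹' B = Set.univ.pi fun i => Set.Ici (b i) := by
    ext u
    simp [B, quantizeParam_secret hg, Pi.le_def]
  have hpos : 0 < quantizationMechanism g lo s θ B := by
    change 0 < (quantizeNoise s).map (quantizeParam g lo s θ) B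
    rw [Measure.map_apply (measurable_quantizeParam_right g lo s θ) hB, hpre, quantizeNoise,
      Measure.pi_pi, CanonicallyOrderedAdd.prod_pos]
    intro i _
    have hsub : Set.Ioo (max 0 (b i)) (s i) ⊆ Set.Ioo 0 (s i) ∩ Set.Ici (b i) := fun x hx =>
      ⟨⟨(le_max_left _ _).trans_lt hx.1, hx.2⟩, (le_max_right _ _).trans hx.1.le⟩
    have hvol : 0 < volume (Set.Ioo (max 0 (b i)) (s i)) := by simp [hs i, hb i]
    rw [cond_apply measurableSet_Ioo]
    exact ENNReal.mul_pos (by simp) (hvol.trans_le (measure_mono hsub)).ne'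
  obtain ⟨θ', hmem, hθ'⟩ := Measure.nonempty_inter_support_of_pos hpos
  exact ⟨θ', hθ', hmem⟩

lemma UniformSecretsPrior.sd_nonneg_of_mem_support_quantizationMechanism
    (hP : UniformSecretsPrior P g lo hi) (hg : Function.Injective g) (hs : ∀ i, 0 < s i)
    (hlohi : ∀ i, lo i < hi i) (hθ : θ ∈ P.support)
    (hθ' : θ' ∈ (quantizationMechanism g lo s θ).support) (j : Fin k) : 0 ≤ θ' (Sum.inr j) := by
  by_cases hj : Sum.inr j ∈ Set.range g
  · obtain ⟨i, hi⟩ := hj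
    rw [← hi]
    calc 0 ≤ lo i := hP.lo_nonneg hlohi hi
      _ ≤ gridFloor (lo i) (s i) (θ (g i)) :=
        le_gridFloor (hs i).le (hP.lo_le_of_mem_support hθ i)
      _ ≤ θ' (g i) := (secret_mem_Icc_of_mem_support_quantizationMechanism hg hs hθ' i).1
  · rw [nonsecret_eq_of_mem_support_quantizationMechanism hs hθ' hj]
    exact hP.sd_nonneg_of_mem_support hθ j

lemma UniformSecretsPrior.wasserstein2_of_mem_support_quantizationMechanism
    (hP : UniformSecretsPrior P g lo hi) (hg : Function.Injective g) (hs : ∀ i, 0 < s i)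
    (hlohi : ∀ i, lo i < hi i) (hθ : θ ∈ P.support)
    (hθ' : θ' ∈ (quantizationMechanism g lo s θ).support) :
    wasserstein2 (gaussLaw θ) (gaussLaw θ')
      = ENNReal.ofReal √(∑ i, (θ (g i) - θ' (g i)) ^ 2) := by
  rw [wasserstein2_gaussLaw, absSd_eq_self (hP.sd_nonneg_of_mem_support hθ),
    absSd_eq_self (hP.sd_nonneg_of_mem_support_quantizationMechanism hg hs hlohi hθ hθ'),
    edist_toLp_two_eq]
  congr 2
  refine (Fintype.sum_of_injective g hg _ _ (fun j hj => ?_) fun i => rfl).symm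
  rw [nonsecret_eq_of_mem_support_quantizationMechanism hs hθ' hj, sub_self, zero_pow two_ne_zero]

lemma UniformSecretsPrior.distortion_quantizationMechanism_le
    (hP : UniformSecretsPrior P g lo hi) (hg : Function.Injective g) (hs : ∀ i, 0 < s i)
    (hlohi : ∀ i, lo i < hi i) :
    distortion P (quantizationMechanism g lo s) ≤ ENNReal.ofReal √(∑ i, s i ^ 2) := by
  refine iSup₂_le fun θ hθ => iSup₂_le fun θ' hθ' => ?_
  rw [hP.wasserstein2_of_mem_support_quantizationMechanism hg hs hlohi hθ hθ']
  refine ENNReal.ofReal_le_ofReal (Real.sqrt_le_sqrt (Finset.sum_le_sum fun i _ => ?_))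
  have hreleased := secret_mem_Icc_of_mem_support_quantizationMechanism hg hs hθ' i
  have hsecret := mem_Ico_gridFloor (hs i) (lo i) (θ (g i))
  exact sq_le_sq' (by linarith [hreleased.2, hsecret.1]) (by linarith [hreleased.1, hsecret.2])

/-- A secret near the left end of its range can be released as a value near the right end of its
cell. -/
lemma UniformSecretsPrior.mul_le_distortion_quantizationMechanism
    (hP : UniformSecretsPrior P g lo hi) (hg : Function.Injective g) (hs : ∀ i, 0 < s i)
    (hlohi : ∀ i, lo i < hi i) {a : ℝ} (ha : a ∈ Set.Ioo 0 1) :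
    ENNReal.ofReal (a * √(∑ i, s i ^ 2)) ≤ distortion P (quantizationMechanism g lo s) := by
  obtain ⟨θ, hθ, hsecret⟩ := hP.exists_mem_support hlohi (b := fun i => lo i + (1 - a) / 2 * s i)
    fun i => lt_add_of_pos_right _ (mul_pos (by linarith [ha.2]) (hs i))
  obtain ⟨θ', hθ', hreleased⟩ := exists_mem_support_quantizationMechanism (lo := lo) hg hs θ
    (b := fun i => (1 + a) / 2 * s i) fun i => by nlinarith [ha.2, hs i]
  refine le_trans ?_ (wasserstein2_le_distortion hθ hθ')
  rw [hP.wasserstein2_of_mem_support_quantizationMechanism hg hs hlohi hθ hθ']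
  refine ENNReal.ofReal_le_ofReal (mul_sqrt_sum_sq_le ha.1.le (fun i => (hs i).le) fun i => ?_)
  have hfloor : lo i ≤ gridFloor (lo i) (s i) (θ (g i)) := le_gridFloor (hs i).le (hsecret i).1
  linarith [(hsecret i).2, hreleased i, neg_le_abs (θ (g i) - θ' (g i))]

theorem UniformSecretsPrior.distortion_quantizationMechanism
    (hP : UniformSecretsPrior P g lo hi) (hg : Function.Injective g) (hs : ∀ i, 0 < s i)
    (hlohi : ∀ i, lo i < hi i) :
    distortion P (quantizationMechanism g lo s) = ENNReal.ofReal √(∑ i, s i ^ 2) := by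
  refine (hP.distortion_quantizationMechanism_le hg hs hlohi).antisymm ?_
  have hcont : Continuous fun a : ℝ => ENNReal.ofReal (a * √(∑ i, s i ^ 2)) :=
    ENNReal.continuous_ofReal.comp (by fun_prop)
  have hlim : Filter.Tendsto (fun a : ℝ => ENNReal.ofReal (a * √(∑ i, s i ^ 2)))
      (nhdsWithin 1 (Set.Iio 1)) (nhds (ENNReal.ofReal √(∑ i, s i ^ 2))) :=
    (hcont.tendsto' 1 _ (by rw [one_mul])).mono_left nhdsWithin_le_nhds
  refine le_of_tendsto hlim ?_
  filter_upwards [Ioo_mem_nhdsLT zero_lt_one] with a ha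
  exact hP.mul_le_distortion_quantizationMechanism hg hs hlohi ha

end Distortion

/-! ### The trade-off constant -/

section TradeoffConst

variable {ι : Type*} [Fintype ι]

/-- Mahler's inequality, from AM-GM applied to `x / (x + y)` and `y / (x + y)`. -/
lemma geom_mean_weighted_add_le {w x y : ι → ℝ} (hw : ∀ i, 0 ≤ w i) (hw_sum : ∑ i, w i = 1)
    (hx : ∀ i, 0 ≤ x i) (hy : ∀ i, 0 < y i) :
    ∏ i, x i ^ w i + ∏ i, y i ^ w i ≤ ∏ i, (x i + y i) ^ w i := by
  have hxy (i : ι) : 0 < x i + y i := add_pos_of_nonneg_of_pos (hx i) (hy i)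
  have hfactor {z : ι → ℝ} (hz : ∀ i, 0 ≤ z i) :
      ∏ i, z i ^ w i = (∏ i, (z i / (x i + y i)) ^ w i) * ∏ i, (x i + y i) ^ w i := by
    rw [← Finset.prod_mul_distrib]
    refine Finset.prod_congr rfl fun i _ => ?_
    rw [← Real.mul_rpow (div_nonneg (hz i) (hxy i).le) (hxy i).le, div_mul_cancel₀ _ (hxy i).ne']
  have hamgm {z : ι → ℝ} (hz : ∀ i, 0 ≤ z i) :
      ∏ i, (z i / (x i + y i)) ^ w i ≤ ∑ i, w i * (z i / (x i + y i)) :=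
    Real.geom_mean_le_arith_mean_weighted _ _ _ (fun i _ => hw i) hw_sum
      fun i _ => div_nonneg (hz i) (hxy i).le
  have hle_one : ∏ i, (x i / (x i + y i)) ^ w i + ∏ i, (y i / (x i + y i)) ^ w i ≤ 1 := by
    refine (add_le_add (hamgm hx) (hamgm fun i => (hy i).le)).trans_eq ?_
    simp_rw [← Finset.sum_add_distrib, ← mul_add, ← add_div, fun i => div_self (hxy i).ne', mul_one,
      hw_sum]
  rw [hfactor hx, hfactor fun i => (hy i).le, ← add_mul]
  exact mul_le_of_le_one_left (Finset.prod_nonneg fun i _ => Real.rpow_nonneg (hxy i).le _) hle_one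

lemma add_geom_mean_pow_card_le [Nonempty ι] {ε : ι → ℝ} (hε : ∀ i, 0 < ε i) {r : ℝ}
    (hr : 0 ≤ r) :
    (r + (∏ i, ε i) ^ (1 / Fintype.card ι : ℝ)) ^ Fintype.card ι ≤ ∏ i, (r + ε i) := by
  have hn : (Fintype.card ι : ℝ) ≠ 0 := Nat.cast_ne_zero.2 Fintype.card_ne_zero
  have hmean := geom_mean_weighted_add_le (w := fun _ : ι => (1 / Fintype.card ι : ℝ))
    (fun _ => by positivity) (by simp [hn]) (fun _ => hr) hε
  rw [Real.finsetProd_rpow _ _ fun _ _ => hr, Real.finsetProd_rpow _ _ fun i _ => (hε i).le,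
    Real.finsetProd_rpow _ _ fun i _ => (add_pos_of_nonneg_of_pos hr (hε i)).le,
    Finset.prod_const, Finset.card_univ, one_div, Real.pow_rpow_inv_natCast hr Fintype.card_ne_zero]
    at hmean
  rw [one_div]
  refine (pow_le_pow_left₀ (add_nonneg hr (Real.rpow_nonneg
    (Finset.prod_nonneg fun i _ => (hε i).le) _)) hmean _).trans_eq ?_
  exact Real.rpow_inv_natCast_pow
    (Finset.prod_nonneg fun i _ => (add_pos_of_nonneg_of_pos hr (hε i)).le) Fintype.card_ne_zero

lemma mul_geom_mean_le_of_prod_le [Nonempty ι] {ε s : ι → ℝ} (hε : ∀ i, 0 < ε i) {c r : ℝ}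
    (hr : 0 ≤ r) (hc : ∀ i, ε i / s i ≤ c) (hc_lt : 2 * c < 1)
    (hprod : ∏ i, (1 - 2 * ε i / s i) ≤ ∏ i, (1 - ε i / (r + ε i))) :
    (1 - 2 * c) * (∏ i, ε i) ^ (1 / Fintype.card ι : ℝ) ≤ 2 * c * r := by
  have hrε (i : ι) : 0 < r + ε i := add_pos_of_nonneg_of_pos hr (hε i)
  set G := (∏ i, ε i) ^ (1 / Fintype.card ι : ℝ)
  have hG : 0 ≤ G := Real.rpow_nonneg (Finset.prod_nonneg fun i _ => (hε i).le) _
  have hpow : ((1 - 2 * c) * (r + G)) ^ Fintype.card ι ≤ r ^ Fintype.card ι := by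
    calc ((1 - 2 * c) * (r + G)) ^ Fintype.card ι
        = (∏ _i : ι, (1 - 2 * c)) * (r + G) ^ Fintype.card ι := by
          rw [mul_pow, Finset.prod_const, Finset.card_univ]
      _ ≤ (∏ i, (1 - ε i / (r + ε i))) * ∏ i, (r + ε i) := by
          refine mul_le_mul (le_trans ?_ hprod) (add_geom_mean_pow_card_le hε hr) (by positivity) ?_
          · refine Finset.prod_le_prod (fun _ _ => by linarith) fun i _ => ?_
            rw [mul_div_assoc]
            linarith [hc i]
          · exact Finset.prod_nonneg fun i _ =>
              sub_nonneg.2 ((div_le_one (hrε i)).2 (le_add_of_nonneg_left hr))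
      _ = ∏ _i : ι, r := by
          rw [← Finset.prod_mul_distrib]
          refine Finset.prod_congr rfl fun i _ => ?_
          rw [sub_mul, one_mul, div_mul_cancel₀ _ (hrε i).ne', add_sub_cancel_right]
      _ = r ^ Fintype.card ι := by rw [Finset.prod_const, Finset.card_univ]
  linarith [le_of_pow_le_pow_left₀ Fintype.card_ne_zero hr hpow]

lemma sqrt_sum_sq_pos [Nonempty ι] {x : ι → ℝ} (hx : ∀ i, 0 < x i) : 0 < √(∑ i, x i ^ 2) :=
  Real.sqrt_pos.2 (Finset.sum_pos (fun i _ => pow_pos (hx i) 2) Finset.univ_nonempty)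

variable {d : ℕ}

lemma le_iSup_div (ε s : Fin d → ℝ) (i : Fin d) : ε i / s i ≤ ⨆ i, ε i / s i :=
  le_ciSup (f := fun i => ε i / s i) (Set.finite_range _).bddAbove i

variable [NeZero d] {ε s : Fin d → ℝ}

lemma iInf_div_pos (hε : ∀ i, 0 < ε i) (hs : ∀ i, 0 < s i) : 0 < ⨅ i, ε i / s i := by
  obtain ⟨i, hi⟩ := exists_eq_ciInf_of_finite (f := fun i => ε i / s i)
  rw [← hi]
  exact div_pos (hε i) (hs i)

lemma two_mul_iSup_div_lt_one (hs : ∀ i, 0 < s i) (hεs : ∀ i, 2 * ε i < s i) :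
    2 * (⨆ i, ε i / s i) < 1 := by
  obtain ⟨i, hi⟩ := exists_eq_ciSup_of_finite (f := fun i => ε i / s i)
  rw [← hi, ← mul_div_assoc, div_lt_one (hs i)]
  exact hεs i

lemma tradeoffConst_pos (hε : ∀ i, 0 < ε i) (hεs : ∀ i, 2 * ε i < s i) :
    0 < tradeoffConst ε s := by
  have hs (i : Fin d) : 0 < s i := by linarith [hε i, hεs i]
  have hc₁ := iInf_div_pos hε hs
  have hc₂ : 0 < ⨆ i, ε i / s i := (div_pos (hε 0) (hs 0)).trans_le (le_iSup_div ε s 0)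
  have hc₂_lt : 0 < 1 - 2 * ⨆ i, ε i / s i := sub_pos.2 (two_mul_iSup_div_lt_one hs hεs)
  have hG : 0 < ∏ i, ε i := Finset.prod_pos fun i _ => hε i
  have hnorm := sqrt_sum_sq_pos hε
  rw [tradeoffConst]
  positivity

lemma sqrt_sum_sq_le_tradeoffConst_mul (hε : ∀ i, 0 < ε i) (hεs : ∀ i, 2 * ε i < s i) {r : ℝ}
    (hr : 0 ≤ r) (hprod : ∏ i, (1 - 2 * ε i / s i) ≤ ∏ i, (1 - ε i / (r + ε i))) :
    √(∑ i, s i ^ 2) ≤ tradeoffConst ε s * r := by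
  have hs (i : Fin d) : 0 < s i := by linarith [hε i, hεs i]
  have hc₁ := iInf_div_pos hε hs
  have hc₂_lt := two_mul_iSup_div_lt_one hs hεs
  have hgeom := mul_geom_mean_le_of_prod_le hε hr (le_iSup_div ε s) hc₂_lt hprod
  have hnorm := mul_sqrt_sum_sq_le hc₁.le (fun i => (hs i).le) fun i =>
    ((le_div_iff₀ (hs i)).1 (ciInf_le (Set.finite_range fun i => ε i / s i).bddBelow i)).trans
      (le_abs_self (ε i))
  have hG : 0 < (∏ i, ε i) ^ (1 / d : ℝ) :=
    Real.rpow_pos_of_pos (Finset.prod_pos fun i _ => hε i) _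
  rw [Fintype.card_fin] at hgeom
  rw [tradeoffConst]
  set c₁ := ⨅ i, ε i / s i
  set c₂ := ⨆ i, ε i / s i
  set G := (∏ i, ε i) ^ (1 / d : ℝ)
  have hc₂_sub : 0 < 1 - 2 * c₂ := sub_pos.2 hc₂_lt
  calc √(∑ i, s i ^ 2)
      = (c₁ * √(∑ i, s i ^ 2)) * ((1 - 2 * c₂) * G) / (c₁ * ((1 - 2 * c₂) * G)) := by field_simp
    _ ≤ √(∑ i, ε i ^ 2) * (2 * c₂ * r) / (c₁ * ((1 - 2 * c₂) * G)) := by gcongr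
    _ = √(∑ i, ε i ^ 2) / G * (2 * c₂ / (c₁ * (1 - 2 * c₂))) * r := by field_simp

end TradeoffConst

/-! ### Lower bound for the distortion of an arbitrary mechanism -/

section LowerBound

variable {k d : ℕ} {g : Fin d → Fin k ⊕ Fin k} {ε s w : Fin d → ℝ} {P : Measure (GaussParam k)}
  {M : Kernel (GaussParam k) (GaussParam k)}

/-- The attack that, having observed `ω`, guesses a point uniformly distributed in the box with
centre `f ω` and side lengths `2 * w i`. -/
noncomputable def uniformAttack {Ω : Type*} [MeasurableSpace Ω] (f : Ω → Fin d → ℝ)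
    (hf : Measurable f) (w : Fin d → ℝ) : Kernel Ω (Fin d → ℝ) :=
  (Kernel.deterministic f hf ×ₖ Kernel.const Ω (quantizeNoise fun i => 2 * w i)).map
    fun p i => p.1 i - w i + p.2 i

section UniformAttack

variable {Ω : Type*} [MeasurableSpace Ω] {f : Ω → Fin d → ℝ} (hf : Measurable f)

lemma isMarkovKernel_uniformAttack (hw : ∀ i, 0 < w i) : IsMarkovKernel (uniformAttack f hf w) := by
  have := isProbabilityMeasure_quantizeNoise fun i => mul_pos two_pos (hw i)
  exact Kernel.IsMarkovKernel.map _ (by fun_prop)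

lemma uniformAttack_apply (hw : ∀ i, 0 < w i) (ω : Ω) :
    uniformAttack f hf w ω
      = (quantizeNoise fun i => 2 * w i).map fun u i => f ω i - w i + u i := by
  have := isProbabilityMeasure_quantizeNoise fun i => mul_pos two_pos (hw i)
  rw [uniformAttack, Kernel.map_apply _ (by fun_prop), Kernel.prod_apply,
    Kernel.deterministic_apply, Kernel.const_apply, Measure.dirac_prod,
    Measure.map_map (by fun_prop) measurable_prodMk_left]
  rfl

lemma uniformAttack_exists_abs_sub_le_eq (hε : ∀ i, 0 < ε i) {ω : Ω} {a : Fin d → ℝ}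
    (haw : ∀ i, |a i - f ω i| + ε i ≤ w i) :
    uniformAttack f hf w ω {guess | ∃ i, |guess i - a i| ≤ ε i}
      = ENNReal.ofReal (1 - ∏ i, (1 - ε i / w i)) := by
  have hw (i : Fin d) : 0 < w i := by linarith [hε i, haw i, abs_nonneg (a i - f ω i)]
  have hset : MeasurableSet {guess : Fin d → ℝ | ∃ i, |guess i - a i| ≤ ε i} :=
    measurable_prodMk_left (x := a) (measurableSet_exists_abs_sub_le ε)
  have hpre : (fun (u : Fin d → ℝ) i => f ω i - w i + u i) ⁻¹' {guess | ∃ i, |guess i - a i| ≤ ε i}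
      = {u | ∃ i, |(a i - f ω i + w i) - u i| ≤ ε i} := by
    ext u
    simp only [Set.mem_preimage, Set.mem_ofPred_eq]
    refine exists_congr fun i => ?_
    rw [abs_sub_comm]
    ring_nf
  rw [uniformAttack_apply hf hw, Measure.map_apply (by fun_prop) hset, hpre,
    quantizeNoise_exists_abs_sub_le_eq hε]
  · simp_rw [mul_div_mul_left _ _ (two_ne_zero (α := ℝ))]
  · intro i
    linarith [haw i, neg_abs_le (a i - f ω i)]
  · intro i
    linarith [haw i, le_abs_self (a i - f ω i)]

end UniformAttack

lemma le_unionPrivacy_of_ae_close [IsProbabilityMeasure P] [IsMarkovKernel M]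
    (hε : ∀ i, 0 < ε i) (hw : ∀ i, 0 < w i) {f : GaussParam k → Fin d → ℝ} (hf : Measurable f)
    (hclose : ∀ᵐ θ ∂P, ∀ᵐ θ' ∂(M θ), ∀ i, |θ (g i) - f θ' i| + ε i ≤ w i) :
    ENNReal.ofReal (1 - ∏ i, (1 - ε i / w i)) ≤ unionPrivacy P g ε M := by
  refine le_iSup₂_of_le (uniformAttack f hf w) (isMarkovKernel_uniformAttack hf hw) ?_
  calc ENNReal.ofReal (1 - ∏ i, (1 - ε i / w i))
      = ∫⁻ _, ∫⁻ _, ENNReal.ofReal (1 - ∏ i, (1 - ε i / w i)) ∂(M _) ∂P := by simp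
    _ ≤ ∫⁻ θ, ∫⁻ θ', uniformAttack f hf w θ' {guess | ∃ i, |guess i - θ (g i)| ≤ ε i}
          ∂(M θ) ∂P :=
        lintegral_mono_ae <| hclose.mono fun θ hθ => lintegral_mono_ae <| hθ.mono fun θ' hθ' =>
          (uniformAttack_exists_abs_sub_le_eq hf hε hθ').ge

lemma ae_abs_sub_absSd_le (hsd : ∀ᵐ θ ∂P, ∀ j, 0 ≤ θ (Sum.inr j)) {r : ℝ} (hr : 0 ≤ r)
    (hdist : distortion P M ≤ ENNReal.ofReal r) :
    ∀ᵐ θ ∂P, ∀ᵐ θ' ∂(M θ), ∀ j, |θ j - absSd θ' j| ≤ r := by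
  filter_upwards [Measure.support_mem_ae (μ := P), hsd] with θ hθ hθ_sd
  filter_upwards [Measure.support_mem_ae (μ := M θ)] with θ' hθ' j
  rw [← absSd_eq_self hθ_sd, ← Real.dist_eq, ← edist_le_ofReal hr]
  calc edist (absSd θ j) (absSd θ' j)
      ≤ edist (WithLp.toLp 2 (absSd θ)) (WithLp.toLp 2 (absSd θ')) :=
        PiLp.edist_apply_le (WithLp.toLp 2 (absSd θ)) (WithLp.toLp 2 (absSd θ')) j
    _ = wasserstein2 (gaussLaw θ) (gaussLaw θ') := (wasserstein2_gaussLaw θ θ').symm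
    _ ≤ distortion P M := wasserstein2_le_distortion hθ hθ'
    _ ≤ ENNReal.ofReal r := hdist

lemma prod_le_prod_of_unionPrivacy_le [IsProbabilityMeasure P] [IsMarkovKernel M]
    (hsd : ∀ᵐ θ ∂P, ∀ j, 0 ≤ θ (Sum.inr j)) (hε : ∀ i, 0 < ε i) (hεs : ∀ i, 2 * ε i < s i)
    (hM : unionPrivacy P g ε M ≤ ENNReal.ofReal (1 - ∏ i, (1 - 2 * ε i / s i)))
    {r : ℝ} (hr : 0 ≤ r) (hdist : distortion P M ≤ ENNReal.ofReal r) :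
    ∏ i, (1 - 2 * ε i / s i) ≤ ∏ i, (1 - ε i / (r + ε i)) := by
  have hs (i : Fin d) : 0 < s i := by linarith [hε i, hεs i]
  have hattack : ENNReal.ofReal (1 - ∏ i, (1 - ε i / (r + ε i))) ≤ unionPrivacy P g ε M := by
    refine le_unionPrivacy_of_ae_close hε (fun i => add_pos_of_nonneg_of_pos hr (hε i))
      (f := fun θ' i => absSd θ' (g i)) ?_ ?_
    · exact measurable_pi_lambda _ fun i => (measurable_pi_apply (g i)).comp measurable_absSd
    · exact (ae_abs_sub_absSd_le hsd hr hdist).mono fun θ hθ =>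
        hθ.mono fun θ' hθ' i => add_le_add_left (hθ' (g i)) (ε i)
  have hprod_le_one : ∏ i, (1 - 2 * ε i / s i) ≤ 1 := by
    refine Finset.prod_le_one (fun i _ => ?_) fun i _ => ?_
    · exact sub_nonneg.2 ((div_le_one (hs i)).2 (hεs i).le)
    · exact sub_le_self _ (div_nonneg (mul_nonneg two_pos.le (hε i).le) (hs i).le)
  linarith [(ENNReal.ofReal_le_ofReal_iff (sub_nonneg.2 hprod_le_one)).1 (hattack.trans hM)]

theorem le_distortion_of_unionPrivacy_le [NeZero d] [IsProbabilityMeasure P] [IsMarkovKernel M]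
    (hsd : ∀ᵐ θ ∂P, ∀ j, 0 ≤ θ (Sum.inr j)) (hε : ∀ i, 0 < ε i) (hεs : ∀ i, 2 * ε i < s i)
    (hM : unionPrivacy P g ε M ≤ ENNReal.ofReal (1 - ∏ i, (1 - 2 * ε i / s i))) :
    ENNReal.ofReal (√(∑ i, s i ^ 2) / tradeoffConst ε s) ≤ distortion P M := by
  rcases eq_or_ne (distortion P M) ⊤ with htop | htop
  · exact htop ▸ le_top
  have hdist := (ENNReal.ofReal_toReal htop).ge
  refine (ENNReal.ofReal_le_ofReal ((div_le_iff₀' (tradeoffConst_pos hε hεs)).2 ?_)).trans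
    (ENNReal.ofReal_toReal htop).le
  exact sqrt_sum_sq_le_tradeoffConst_mul hε hεs ENNReal.toReal_nonneg
    (prod_le_prod_of_unionPrivacy_le hsd hε hεs hM ENNReal.toReal_nonneg hdist)

theorem le_optDistortion [NeZero d] [IsProbabilityMeasure P]
    (hsd : ∀ᵐ θ ∂P, ∀ j, 0 ≤ θ (Sum.inr j)) (hε : ∀ i, 0 < ε i) (hεs : ∀ i, 2 * ε i < s i) :
    ENNReal.ofReal (√(∑ i, s i ^ 2) / tradeoffConst ε s)
      ≤ optDistortion P g ε (ENNReal.ofReal (1 - ∏ i, (1 - 2 * ε i / s i))) :=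
  le_iInf₂ fun _ _ => le_iInf fun hM => le_distortion_of_unionPrivacy_le hsd hε hεs hM

end LowerBound

theorem mainTheorem5 {k d : ℕ} (hd : 0 < d)
    (g : Fin d → Fin k ⊕ Fin k) (hg : Function.Injective g)
    (ε s lo : Fin d → ℝ) (m : Fin d → ℕ)
    (hε : ∀ i, 0 < ε i) (hεs : ∀ i, 2 * ε i < s i) (hm : ∀ i, 0 < m i)
    (P : Measure (GaussParam k))
    (hP : UniformSecretsPrior P g lo fun i => lo i + m i * s i) :
    unionPrivacy P g ε (quantizationMechanism g lo s)
        = ENNReal.ofReal (1 - ∏ i, (1 - 2 * ε i / s i)) ∧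
      distortion P (quantizationMechanism g lo s) = ENNReal.ofReal √(∑ i, s i ^ 2) ∧
      ∀ c : ℝ, tradeoffConst ε s < c →
        distortion P (quantizationMechanism g lo s)
          < ENNReal.ofReal c *
            optDistortion P g ε (unionPrivacy P g ε (quantizationMechanism g lo s)) := by
  have hs (i : Fin d) : 0 < s i := by linarith [hε i, hεs i]
  have hlohi (i : Fin d) : lo i < lo i + m i * s i :=
    lt_add_of_pos_right _ (mul_pos (Nat.cast_pos.2 (hm i)) (hs i))
  have : NeZero d := ⟨hd.ne'⟩
  have := hP.isProbabilityMeasure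
  have hpriv := unionPrivacy_quantizationMechanism hg hε hεs hP
  have hdist := hP.distortion_quantizationMechanism hg hs hlohi
  refine ⟨hpriv, hdist, fun c hc => ?_⟩
  have hC := tradeoffConst_pos hε hεs
  have hnorm := sqrt_sum_sq_pos hs
  rw [hdist, hpriv]
  calc ENNReal.ofReal √(∑ i, s i ^ 2)
      < ENNReal.ofReal (c * (√(∑ i, s i ^ 2) / tradeoffConst ε s)) := by
        refine (ENNReal.ofReal_lt_ofReal_iff (by have := hC.trans hc; positivity)).2 ?_
        rw [← mul_div_assoc, lt_div_iff₀ hC, mul_comm]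
        exact mul_lt_mul_of_pos_right hc hnorm
    _ = ENNReal.ofReal c * ENNReal.ofReal (√(∑ i, s i ^ 2) / tradeoffConst ε s) :=
        ENNReal.ofReal_mul (hC.trans hc).le
    _ ≤ _ := mul_le_mul_right (le_optDistortion hP.sd_nonneg hε hεs) _
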